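/- Let $n\ge 1$. A convex body is a non-empty compact convex subset of $\mathbb{R}^n$, and $\mathcal K^n$ denotes the family of convex bodies. Let $C\in\mathcal K^n$ have non-empty interior. For $K\in\mathcal K^n$ put $h(K,a)=\max\{a^Tx: x\in K\}$; let $R(L,C)$ be the smallest $\rho\ge 0$ such that some translate of $\rho C$ contains the set $L$; and define the diameter, the breadth in direction $s\neq 0$, and the (minimal) width of $K$ with respect to $C$ by \[ D(K,C)=2\max_{x,y\in K}R([x,y],C),\qquad b_s(K,C)=\frac{2h(K-K,s)}{h(C-C,s)},\qquad w(K,C)=\min_{s\in\mathbb{R}^n\setminus\{0\}} b_s(K,C). \] The body $K$ is complete with respect to $C$ if $D(K',C)>D(K,C)$ for every $K'\in\mathcal K^n$ with $K'\supsetneq K$; a completion of $K$ is a $K^*\in\mathcal K^n$ that is complete with respect to $C$ and satisfies $K\subseteq K^*$ and $D(K,C)=D(K^*,C)$; $K$ is of constant width with respect to $C$ if $w(K,C)=D(K,C)$; and $C$ is perfect if every $K\in\mathcal K^n$ that is complete with respect to $C$ is of constant width with respect to $C$. Then the following are equivalent: (i) $C$ is perfect. (ii) For every $K\in\mathcal K^n$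 and every completion $K^*$ of $K$ with respect to $C$, \[ w(\lambda K+(1-\lambda)K^*,C)=\lambda\, w(K,C)+(1-\lambda)\,w(K^*,C)\qquad\text{for all }\lambda\in[0,1]. \] -/

import Mathlib

open scoped Pointwise

noncomputable section

namespace ConvexGauge

variable {n : ℕ}

/-- The support function `h(K, a) = max {aᵀ x : x ∈ K}`. -/
def supportFn (K : Set (EuclideanSpace ℝ (Fin n))) (a : EuclideanSpace ℝ (Fin n)) : ℝ :=
  sSup ((fun x => inner ℝ a x) '' K)

/-- The circumradius `R(K, C)`: the smallest `ρ ≥ 0` such that some translate of `ρ C`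
contains `K`. -/
def circumradius (K C : Set (EuclideanSpace ℝ (Fin n))) : ℝ :=
  sInf {ρ : ℝ | 0 ≤ ρ ∧ ∃ c : EuclideanSpace ℝ (Fin n), K ⊆ c +ᵥ ρ • C}

/-- The diameter `D(K, C) = 2 max {R([x, y], C) : x, y ∈ K}`. -/
def diameter (K C : Set (EuclideanSpace ℝ (Fin n))) : ℝ :=
  2 * sSup {r : ℝ | ∃ x ∈ K, ∃ y ∈ K, r = circumradius (segment ℝ x y) C}

/-- The breadth `b_s(K, C) = 2 h(K - K, s) / h(C - C, s)` in direction `s`. -/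
def breadth (s : EuclideanSpace ℝ (Fin n)) (K C : Set (EuclideanSpace ℝ (Fin n))) : ℝ :=
  2 * supportFn (K - K) s / supportFn (C - C) s

/-- The minimal width `w(K, C) = min {b_s(K, C) : s ≠ 0}`. -/
def width (K C : Set (EuclideanSpace ℝ (Fin n))) : ℝ :=
  sInf {b : ℝ | ∃ s : EuclideanSpace ℝ (Fin n), s ≠ 0 ∧ b = breadth s K C}

/-- `K` is (diametrically) complete with respect to `C`: every convex body that properly
contains `K` has larger diameter. -/
def IsCompleteBody (K C : ConvexBody (EuclideanSpace ℝ (Fin n))) : Prop :=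
  ∀ K' : ConvexBody (EuclideanSpace ℝ (Fin n)),
    (K : Set (EuclideanSpace ℝ (Fin n))) ⊂ K' →
      diameter (K : Set (EuclideanSpace ℝ (Fin n))) C
        < diameter (K' : Set (EuclideanSpace ℝ (Fin n))) C

/-- `Kstar` is a completion of `K` with respect to `C`. -/
def IsCompletionOf (Kstar K C : ConvexBody (EuclideanSpace ℝ (Fin n))) : Prop :=
  (K : Set (EuclideanSpace ℝ (Fin n))) ⊆ Kstar ∧
    diameter (K : Set (EuclideanSpace ℝ (Fin n))) C
      = diameter (Kstar : Set (EuclideanSpace ℝ (Fin n))) C ∧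
    IsCompleteBody Kstar C

/-- `K` is of constant width with respect to `C`. -/
def IsConstantWidth (K C : ConvexBody (EuclideanSpace ℝ (Fin n))) : Prop :=
  width (K : Set (EuclideanSpace ℝ (Fin n))) C
    = diameter (K : Set (EuclideanSpace ℝ (Fin n))) C

/-- `C` is perfect: every body that is complete with respect to `C` is of constant width with
respect to `C`. -/
def IsPerfect (C : ConvexBody (EuclideanSpace ℝ (Fin n))) : Prop :=
  ∀ K : ConvexBody (EuclideanSpace ℝ (Fin n)), IsCompleteBody K C → IsConstantWidth K C

end ConvexGauge

end

/-!
The difference body `C - C` carries the whole problem. The diameter of `K` is at most `d` exactly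
when `K - K ⊆ (d / 2) • (C - C)` (`diameter_le_iff`), so the diameter is the largest breadth, and
`K` has constant width exactly when all its breadths agree. Breadth is affine along Minkowski
segments (`breadth_combo`), so adding a body of constant width shifts all breadths by the same
constant, and width is affine towards completions when `C` is perfect
(`width_combo_of_isConstantWidth`).

For the converse it suffices to find, inside a complete body `K` that is not of constant width, a
convex body `M` of the same diameter `d` such that no direction attains the width of both `M` and
`K`: equality at the midpoint of `M` and `K` would produce a common minimizing direction.

Let `B = (d / 2) • (C - C)`, whose support function is `diffSupport C d`, and let `c + R • B` be a
ball of smallest radius `R` containing `K`. Let `Γ` be the set of normals, scaled to have support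
value `1`, of its contacts with `K`. By optimality `0` is a convex combination of `Γ`
(`exists_optimal_center`). Since `K` is complete, it contains `c + (1 - R) • B`
(`IsCompleteBody.add_mem`), and hence `R ≤ 1 / 2` would force constant width. For `s ∈ Γ` the body
`K` has the maximal extent `1`, from `-(1 - R)` to `R` relative to `c`. Choose `i ∈ Γ` of positive
weight, a contact `y` of the circumscribed ball at height `R` in direction `i`, and a point `x` of
the inscribed ball at height `-(1 - R)`; these form a diametral pair. Since
`⟪i, (x - c) + (y - c)⟫ = R - (1 - R) > 0`, there is `s ∈ Γ` with `⟪s, (x - c) + (y - c)⟫ < 0`. Both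
summands are at least `-(1 - R)`, so both are strictly less than `1 - R`. Hence cutting `K` slightly
below the height `1 - R` in direction `s` preserves the diameter, while the extent in direction `s`
drops below `2 * (1 - R)`. The truncated inscribed ball remains strictly longer than that in every
other direction (`lt_supportFn_of_truncated_ball`), so the width of the rest `M` is attained only at
`± s`, where `K` has breadth `d` (`IsCompleteBody.exists_cut`).
-/

namespace ConvexGauge

variable {n : ℕ}

/-! ### Convex hulls of compact sets -/

/-- By Carathéodory's theorem the convex hull of a compact set is a continuous image of the
product of a simplex and finitely many copies of the set. -/
theorem isCompact_convexHull_of_isCompact {E : Type*} [NormedAddCommGroup E] [NormedSpace ℝ E]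
    [FiniteDimensional ℝ E] {s : Set E} (hs : IsCompact s) : IsCompact (convexHull ℝ s) := by
  rcases s.eq_empty_or_nonempty with rfl | ⟨x₀, hx₀⟩
  · simp
  set N := Module.finrank ℝ E + 1 with hN
  have himage : convexHull ℝ s = (fun p : (Fin N → ℝ) × (Fin N → E) => ∑ i, p.1 i • p.2 i) ''
      (stdSimplex ℝ (Fin N) ×ˢ Set.univ.pi fun _ => s) := by
    apply Set.Subset.antisymm
    · intro x hx
      obtain ⟨ι, _, z, w, hz, hind, hw, hw1, hx⟩ := eq_pos_convex_span_of_mem_convexHull hx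
      have hcard : Fintype.card ι ≤ Fintype.card (Fin N) := by
        rw [Fintype.card_fin]
        exact hind.card_le_finrank_succ.trans (Nat.succ_le_succ (Submodule.finrank_le _))
      obtain ⟨e⟩ := Function.Embedding.nonempty_of_card_le hcard
      have hout : ∀ j ∉ Set.range e, Function.extend e w 0 j = 0 := fun j hj =>
        Function.extend_apply' _ _ _ fun ⟨i, hi⟩ => hj ⟨i, hi⟩
      refine ⟨(Function.extend e w 0, Function.extend e z fun _ => x₀), ⟨⟨fun j => ?_, ?_⟩, ?_⟩, ?_⟩
      · by_cases hj : j ∈ Set.range e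
        · obtain ⟨i, rfl⟩ := hj
          simpa only [e.injective.extend_apply] using (hw i).le
        · exact (hout j hj).ge
      · rw [← hw1]
        exact (Fintype.sum_of_injective e e.injective _ _ hout
          fun i => (e.injective.extend_apply _ _ _).symm).symm
      · intro j _
        by_cases hj : j ∈ Set.range e
        · obtain ⟨i, rfl⟩ := hj
          simpa only [e.injective.extend_apply] using hz ⟨i, rfl⟩
        · have : Function.extend e z (fun _ => x₀) j = x₀ :=
            Function.extend_apply' _ _ _ fun ⟨i, hi⟩ => hj ⟨i, hi⟩
          simpa only [this] using hx₀
      · rw [← hx]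
        refine (Fintype.sum_of_injective e e.injective _ _ (fun j hj => ?_) fun i => ?_).symm
        · simp only [hout j hj, zero_smul]
        · simp only [e.injective.extend_apply]
    · rintro _ ⟨⟨w, z⟩, ⟨hw, hz⟩, rfl⟩
      exact (convex_convexHull ℝ s).sum_mem (fun i _ => hw.1 i) hw.2
        fun i _ => subset_convexHull ℝ s (hz i trivial)
  rw [himage]
  refine ((isCompact_stdSimplex ℝ (Fin N)).prod (isCompact_univ_pi fun _ => hs)).image ?_
  fun_prop

/-! ### Support functions -/

section Support

variable {K L : Set (EuclideanSpace ℝ (Fin n))} {a x : EuclideanSpace ℝ (Fin n)} {r : ℝ}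

theorem isCompact_sub (hK : IsCompact K) (hL : IsCompact L) : IsCompact (K - L) := by
  rw [sub_eq_add_neg]
  exact hK.add hL.neg

theorem bddAbove_inner_image (hK : IsCompact K) : BddAbove ((fun x => inner ℝ a x) '' K) :=
  (hK.image (by fun_prop)).bddAbove

theorem inner_le_supportFn (hK : IsCompact K) (hx : x ∈ K) : inner ℝ a x ≤ supportFn K a :=
  le_csSup (bddAbove_inner_image hK) ⟨x, hx, rfl⟩

theorem supportFn_le (hne : K.Nonempty) (h : ∀ x ∈ K, inner ℝ a x ≤ r) : supportFn K a ≤ r := by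
  refine csSup_le (hne.image _) ?_
  rintro _ ⟨x, hx, rfl⟩
  exact h x hx

theorem exists_inner_eq_supportFn (hK : IsCompact K) (hne : K.Nonempty)
    (a : EuclideanSpace ℝ (Fin n)) : ∃ x ∈ K, inner ℝ a x = supportFn K a := by
  obtain ⟨x, hx, h⟩ := (hK.image (f := fun x => inner ℝ a x) (by fun_prop)).sSup_mem (hne.image _)
  exact ⟨x, hx, h⟩

theorem continuous_supportFn (hK : IsCompact K) : Continuous (supportFn K) := by
  unfold supportFn
  refine hK.continuous_sSup (f := fun a x => inner ℝ a x) ?_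
  exact continuous_inner

theorem supportFn_smul_right (hK : IsCompact K) (hne : K.Nonempty) (hr : 0 ≤ r) :
    supportFn K (r • a) = r * supportFn K a := by
  obtain ⟨x, hx, h⟩ := exists_inner_eq_supportFn hK hne a
  apply le_antisymm
  · refine supportFn_le hne fun y hy => ?_
    rw [real_inner_smul_left]
    exact mul_le_mul_of_nonneg_left (inner_le_supportFn hK hy) hr
  · rw [← h, ← real_inner_smul_left]
    exact inner_le_supportFn hK hx

theorem supportFn_smul_left (hK : IsCompact K) (hne : K.Nonempty) (hr : 0 ≤ r) :
    supportFn (r • K) a = r * supportFn K a := by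
  obtain ⟨x, hx, h⟩ := exists_inner_eq_supportFn hK hne a
  apply le_antisymm
  · refine supportFn_le (hne.smul_set) ?_
    rintro _ ⟨y, hy, rfl⟩
    simp only [real_inner_smul_right]
    exact mul_le_mul_of_nonneg_left (inner_le_supportFn hK hy) hr
  · rw [← h, ← real_inner_smul_right]
    exact inner_le_supportFn (hK.smul r) (Set.smul_mem_smul_set hx)

theorem supportFn_add (hK : IsCompact K) (hKne : K.Nonempty) (hL : IsCompact L)
    (hLne : L.Nonempty) : supportFn (K + L) a = supportFn K a + supportFn L a := by
  obtain ⟨x, hx, hxa⟩ := exists_inner_eq_supportFn hK hKne a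
  obtain ⟨y, hy, hya⟩ := exists_inner_eq_supportFn hL hLne a
  apply le_antisymm
  · refine supportFn_le (hKne.add hLne) ?_
    rintro _ ⟨z, hz, w, hw, rfl⟩
    simp only [inner_add_right]
    exact add_le_add (inner_le_supportFn hK hz) (inner_le_supportFn hL hw)
  · rw [← hxa, ← hya, ← inner_add_right]
    exact inner_le_supportFn (hK.add hL) (Set.add_mem_add hx hy)

theorem supportFn_sub (hK : IsCompact K) (hKne : K.Nonempty) (hL : IsCompact L)
    (hLne : L.Nonempty) : supportFn (K - L) a = supportFn K a + supportFn L (-a) := by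
  obtain ⟨x, hx, hxa⟩ := exists_inner_eq_supportFn hK hKne a
  obtain ⟨y, hy, hya⟩ := exists_inner_eq_supportFn hL hLne (-a)
  apply le_antisymm
  · refine supportFn_le (hKne.sub hLne) ?_
    rintro _ ⟨z, hz, w, hw, rfl⟩
    have h1 := inner_le_supportFn (a := a) hK hz
    have h2 := inner_le_supportFn (a := -a) hL hw
    simp only [inner_sub_right]
    rw [inner_neg_left] at h2
    linarith
  · have h := inner_le_supportFn (a := a) (isCompact_sub hK hL) (Set.sub_mem_sub hx hy)
    rw [inner_sub_right] at h
    rw [inner_neg_left] at hya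
    linarith

theorem mem_of_inner_le_supportFn (hK : IsCompact K) (hconv : Convex ℝ K) (hne : K.Nonempty)
    (h : ∀ a, inner ℝ a x ≤ supportFn K a) : x ∈ K := by
  by_contra hx
  obtain ⟨f, u, hf, hu⟩ := geometric_hahn_banach_closed_point hconv hK.isClosed hx
  have hrep : ∀ y, inner ℝ ((InnerProductSpace.toDual ℝ _).symm f) y = f y := fun y =>
    InnerProductSpace.toDual_symm_apply
  obtain ⟨y, hy, hya⟩ :=
    exists_inner_eq_supportFn hK hne ((InnerProductSpace.toDual ℝ _).symm f)
  have h1 := h ((InnerProductSpace.toDual ℝ _).symm f)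
  rw [← hya, hrep, hrep] at h1
  linarith [hf y hy]

theorem supportFn_sub_self_neg (hK : IsCompact K) (hne : K.Nonempty) :
    supportFn (K - K) (-a) = supportFn (K - K) a := by
  rw [supportFn_sub hK hne hK hne, supportFn_sub hK hne hK hne, neg_neg, add_comm]

theorem supportFn_sub_self_nonneg (hK : IsCompact K) (hne : K.Nonempty) :
    0 ≤ supportFn (K - K) a := by
  obtain ⟨x, hx⟩ := hne
  simpa using inner_le_supportFn (a := a) (isCompact_sub hK hK) (Set.sub_mem_sub hx hx)

end Support

/-! ### The difference body of the gauge -/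

section Gauge

variable (C : ConvexBody (EuclideanSpace ℝ (Fin n)))

theorem sub_self_mem_nhds_zero (hC : (interior (C : Set (EuclideanSpace ℝ (Fin n)))).Nonempty) :
    (C - C : Set (EuclideanSpace ℝ (Fin n))) ∈ nhds 0 := by
  obtain ⟨p, hp⟩ := hC
  have h := (continuous_add_const p (M := EuclideanSpace ℝ (Fin n))).continuousAt (x := 0)
  have h2 : (C : Set (EuclideanSpace ℝ (Fin n))) ∈ nhds (0 + p) := by
    rw [zero_add]
    exact mem_interior_iff_mem_nhds.1 hp
  filter_upwards [h h2] with x hx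
  exact ⟨x + p, hx, p, interior_subset hp, by simp⟩

theorem supportFn_sub_self_pos (hC : (interior (C : Set (EuclideanSpace ℝ (Fin n)))).Nonempty)
    {s : EuclideanSpace ℝ (Fin n)} (hs : s ≠ 0) :
    0 < supportFn (C - C : Set (EuclideanSpace ℝ (Fin n))) s := by
  have h0 := sub_self_mem_nhds_zero C hC
  have hlim : Filter.Tendsto (fun ε : ℝ => ε • s) (nhdsWithin 0 (Set.Ioi 0)) (nhds 0) := by
    have : Continuous fun ε : ℝ => ε • s := by fun_prop
    simpa using (this.tendsto 0).mono_left nhdsWithin_le_nhds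
  obtain ⟨ε, hmem, hε⟩ := ((hlim.eventually h0).and self_mem_nhdsWithin).exists
  have h := inner_le_supportFn (a := s) (isCompact_sub C.isCompact C.isCompact) hmem
  rw [real_inner_smul_right] at h
  exact (mul_pos hε (real_inner_self_pos.2 hs)).trans_le h

theorem circumradius_segment (hC : (interior (C : Set (EuclideanSpace ℝ (Fin n)))).Nonempty)
    (x y : EuclideanSpace ℝ (Fin n)) :
    circumradius (segment ℝ x y) C
      = gauge (C - C : Set (EuclideanSpace ℝ (Fin n))) (x - y) := by
  have hiff : ∀ ρ : ℝ, (∃ c : EuclideanSpace ℝ (Fin n),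
      segment ℝ x y ⊆ c +ᵥ ρ • (C : Set (EuclideanSpace ℝ (Fin n)))) ↔
      x - y ∈ ρ • (C - C : Set (EuclideanSpace ℝ (Fin n))) := by
    intro ρ
    constructor
    · rintro ⟨c, hc⟩
      obtain ⟨_, ⟨a, ha, rfl⟩, hxa⟩ := hc (left_mem_segment ℝ x y)
      obtain ⟨_, ⟨b, hb, rfl⟩, hyb⟩ := hc (right_mem_segment ℝ x y)
      refine ⟨a - b, Set.sub_mem_sub ha hb, ?_⟩
      simp only [vadd_eq_add] at hxa hyb
      simp only [← hxa, ← hyb, smul_sub]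
      abel
    · rintro ⟨_, ⟨a, ha, b, hb, rfl⟩, hab⟩
      simp only [smul_sub] at hab
      refine ⟨x - ρ • a, ((C.convex.smul ρ).vadd _).segment_subset
        ⟨ρ • a, Set.smul_mem_smul_set ha, by simp⟩ ⟨ρ • b, Set.smul_mem_smul_set hb, ?_⟩⟩
      have : y = x - (ρ • a - ρ • b) := by rw [hab]; abel
      simp only [vadd_eq_add]
      rw [this]
      abel
  unfold circumradius
  simp only [hiff]
  by_cases hxy : x - y = 0
  · rw [hxy, gauge_zero]
    have h0 : (0 : EuclideanSpace ℝ (Fin n)) ∈ (0 : ℝ) • (C - C : Set (EuclideanSpace ℝ (Fin n))) :=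
      ⟨0, mem_of_mem_nhds (sub_self_mem_nhds_zero C hC), by simp⟩
    exact le_antisymm (csInf_le ⟨0, fun _ h => h.1⟩ ⟨le_rfl, h0⟩) (Real.sInf_nonneg fun _ h => h.1)
  · rw [gauge_def]
    congr 1
    ext ρ
    refine ⟨fun h => ⟨lt_of_le_of_ne h.1 ?_, h.2⟩, fun h => ⟨le_of_lt h.1, h.2⟩⟩
    rintro rfl
    obtain ⟨z, -, hz⟩ := h.2
    exact hxy (by simpa using hz.symm)

/-- The gauge of the difference body is dual to its support function. -/
theorem gauge_sub_self_le_iff (hC : (interior (C : Set (EuclideanSpace ℝ (Fin n)))).Nonempty)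
    {r : ℝ} (hr : 0 ≤ r) (v : EuclideanSpace ℝ (Fin n)) :
    gauge (C - C : Set (EuclideanSpace ℝ (Fin n))) v ≤ r ↔
      ∀ s, inner ℝ s v ≤ r * supportFn (C - C : Set (EuclideanSpace ℝ (Fin n))) s := by
  have hcpt := isCompact_sub C.isCompact C.isCompact
  have hne := C.nonempty.sub C.nonempty
  have hcvx := C.convex.sub C.convex
  have h0 := sub_self_mem_nhds_zero C hC
  constructor
  · intro h s
    have hlim : Filter.Tendsto
        (fun a : ℝ => a * supportFn (C - C : Set (EuclideanSpace ℝ (Fin n))) s)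
        (nhdsWithin r (Set.Ioi r))
        (nhds (r * supportFn (C - C : Set (EuclideanSpace ℝ (Fin n))) s)) :=
      ((continuous_id.mul continuous_const).tendsto r).mono_left nhdsWithin_le_nhds
    refine ge_of_tendsto hlim ?_
    filter_upwards [self_mem_nhdsWithin] with a ha
    obtain ⟨b, hb, hba, z, hz, rfl⟩ :=
      exists_lt_of_gauge_lt (absorbent_nhds_zero h0) (h.trans_lt ha)
    simp only [real_inner_smul_right]
    exact (mul_le_mul_of_nonneg_left (inner_le_supportFn hcpt hz) hb.le).trans
      (mul_le_mul_of_nonneg_right hba.le (supportFn_sub_self_nonneg C.isCompact C.nonempty))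
  · intro h
    refine gauge_le_of_mem hr (mem_of_inner_le_supportFn (hcpt.smul r) (hcvx.smul r)
      hne.smul_set fun s => ?_)
    rw [supportFn_smul_left hcpt hne hr]
    exact h s

end Gauge

/-! ### Diameter, breadth and width -/

section Measures

variable (K L C : ConvexBody (EuclideanSpace ℝ (Fin n)))
  {s : EuclideanSpace ℝ (Fin n)}

/-- The diameter is at most `d` exactly when `K - K ⊆ (d / 2) • (C - C)`, which is expressed here
by support functions. In other words, the diameter is the maximal breadth. -/
theorem diameter_le_iff (hC : (interior (C : Set (EuclideanSpace ℝ (Fin n)))).Nonempty)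
    {d : ℝ} (hd : 0 ≤ d) :
    diameter (K : Set (EuclideanSpace ℝ (Fin n))) C ≤ d ↔
      ∀ s, 2 * supportFn (K - K : Set (EuclideanSpace ℝ (Fin n))) s
        ≤ d * supportFn (C - C : Set (EuclideanSpace ℝ (Fin n))) s := by
  have hset : {r : ℝ | ∃ x ∈ (K : Set (EuclideanSpace ℝ (Fin n))),
      ∃ y ∈ (K : Set (EuclideanSpace ℝ (Fin n))), r = circumradius (segment ℝ x y) C}
      = gauge (C - C : Set (EuclideanSpace ℝ (Fin n))) ''
        (K - K : Set (EuclideanSpace ℝ (Fin n))) := by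
    ext r
    constructor
    · rintro ⟨x, hx, y, hy, rfl⟩
      exact ⟨x - y, Set.sub_mem_sub hx hy, (circumradius_segment C hC x y).symm⟩
    · rintro ⟨_, ⟨x, hx, y, hy, rfl⟩, rfl⟩
      exact ⟨x, hx, y, hy, (circumradius_segment C hC x y).symm⟩
  have hbdd : BddAbove (gauge (C - C : Set (EuclideanSpace ℝ (Fin n))) ''
      (K - K : Set (EuclideanSpace ℝ (Fin n)))) :=
    ((isCompact_sub K.isCompact K.isCompact).image (continuous_gauge (C.convex.sub C.convex)
      (sub_self_mem_nhds_zero C hC))).bddAbove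
  have hne := K.nonempty.sub K.nonempty
  have hle : diameter (K : Set (EuclideanSpace ℝ (Fin n))) C ≤ d ↔
      ∀ v ∈ (K - K : Set (EuclideanSpace ℝ (Fin n))),
        gauge (C - C : Set (EuclideanSpace ℝ (Fin n))) v ≤ d / 2 := by
    unfold diameter
    rw [hset, ← le_div_iff₀' two_pos, csSup_le_iff hbdd (hne.image _), Set.forall_mem_image]
  rw [hle]
  constructor
  · intro h s
    have h1 : supportFn (K - K : Set (EuclideanSpace ℝ (Fin n))) s
        ≤ d / 2 * supportFn (C - C : Set (EuclideanSpace ℝ (Fin n))) s :=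
      supportFn_le hne fun v hv =>
        (gauge_sub_self_le_iff C hC (by positivity) v).1 (h v hv) s
    linarith
  · intro h v hv
    refine (gauge_sub_self_le_iff C hC (by positivity) v).2 fun s => ?_
    have h1 := inner_le_supportFn (a := s) (isCompact_sub K.isCompact K.isCompact) hv
    linarith [h s]

theorem circumradius_nonneg (A B : Set (EuclideanSpace ℝ (Fin n))) : 0 ≤ circumradius A B :=
  Real.sInf_nonneg fun _ h => h.1

theorem diameter_nonneg (A B : Set (EuclideanSpace ℝ (Fin n))) : 0 ≤ diameter A B := by
  refine mul_nonneg zero_le_two (Real.sSup_nonneg ?_)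
  rintro _ ⟨x, -, y, -, rfl⟩
  exact circumradius_nonneg _ _

theorem breadth_nonneg (s : EuclideanSpace ℝ (Fin n)) : 0 ≤ breadth s K C :=
  div_nonneg (mul_nonneg zero_le_two (supportFn_sub_self_nonneg K.isCompact K.nonempty))
    (supportFn_sub_self_nonneg C.isCompact C.nonempty)

theorem breadth_le_diameter (hC : (interior (C : Set (EuclideanSpace ℝ (Fin n)))).Nonempty)
    (hs : s ≠ 0) : breadth s K C ≤ diameter (K : Set (EuclideanSpace ℝ (Fin n))) C := by
  unfold breadth
  rw [div_le_iff₀ (supportFn_sub_self_pos C hC hs)]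
  exact (diameter_le_iff K C hC (diameter_nonneg _ _)).1 le_rfl s

theorem breadth_smul {r : ℝ} (hr : 0 < r) : breadth (r • s) K C = breadth s K C := by
  unfold breadth
  rw [supportFn_smul_right (isCompact_sub K.isCompact K.isCompact) (K.nonempty.sub K.nonempty)
    hr.le, supportFn_smul_right (isCompact_sub C.isCompact C.isCompact)
    (C.nonempty.sub C.nonempty) hr.le, mul_left_comm, mul_div_mul_left _ _ hr.ne']

theorem breadth_neg : breadth (-s) K C = breadth s K C := by
  unfold breadth
  rw [supportFn_sub_self_neg K.isCompact K.nonempty, supportFn_sub_self_neg C.isCompact C.nonempty]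

theorem width_le_breadth (hs : s ≠ 0) :
    width (K : Set (EuclideanSpace ℝ (Fin n))) C ≤ breadth s K C := by
  refine csInf_le ⟨0, ?_⟩ ⟨s, hs, rfl⟩
  rintro _ ⟨t, -, rfl⟩
  exact breadth_nonneg K C t

/-- The breadth is positively homogeneous of degree zero and continuous on the unit sphere, so the
width is attained. -/
theorem exists_breadth_eq_width (hn : 1 ≤ n)
    (hC : (interior (C : Set (EuclideanSpace ℝ (Fin n)))).Nonempty) :
    ∃ s : EuclideanSpace ℝ (Fin n), s ≠ 0 ∧
      breadth s K C = width (K : Set (EuclideanSpace ℝ (Fin n))) C := by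
  have : Nonempty (Fin n) := ⟨⟨0, hn⟩⟩
  have hsphere : (Metric.sphere (0 : EuclideanSpace ℝ (Fin n)) 1).Nonempty :=
    NormedSpace.sphere_nonempty.2 zero_le_one
  have hcont : ContinuousOn (fun s => breadth s (K : Set (EuclideanSpace ℝ (Fin n)))
      (C : Set (EuclideanSpace ℝ (Fin n))))
      (Metric.sphere 0 1) := by
    refine ContinuousOn.div ?_ ?_ fun s hs =>
      (supportFn_sub_self_pos C hC (ne_zero_of_mem_unit_sphere ⟨s, hs⟩)).ne'
    · exact (continuous_const.mul
        (continuous_supportFn (isCompact_sub K.isCompact K.isCompact))).continuousOn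
    · exact (continuous_supportFn (isCompact_sub C.isCompact C.isCompact)).continuousOn
  obtain ⟨s, hs, hmin⟩ := (isCompact_sphere (0 : EuclideanSpace ℝ (Fin n)) 1).exists_isMinOn
    hsphere hcont
  have hs0 : s ≠ 0 := ne_zero_of_mem_unit_sphere ⟨s, hs⟩
  refine ⟨s, hs0, le_antisymm ?_ (width_le_breadth K C hs0)⟩
  refine le_csInf ⟨_, s, hs0, rfl⟩ ?_
  rintro _ ⟨t, ht, rfl⟩
  rw [← breadth_smul (s := t) K C (inv_pos.2 (norm_pos_iff.2 ht))]
  have hmem : ‖t‖⁻¹ • t ∈ Metric.sphere (0 : EuclideanSpace ℝ (Fin n)) 1 := by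
    simp [norm_smul, ht]
  exact hmin hmem

theorem width_le_diameter (hn : 1 ≤ n)
    (hC : (interior (C : Set (EuclideanSpace ℝ (Fin n)))).Nonempty) :
    width (K : Set (EuclideanSpace ℝ (Fin n))) C
      ≤ diameter (K : Set (EuclideanSpace ℝ (Fin n))) C := by
  obtain ⟨s, hs, h⟩ := exists_breadth_eq_width K C hn hC
  exact h ▸ breadth_le_diameter K C hC hs

/-- Breadth is affine along Minkowski segments of convex bodies. -/
theorem breadth_combo {t : ℝ} (ht : t ∈ Set.Icc (0 : ℝ) 1) (s : EuclideanSpace ℝ (Fin n)) :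
    breadth s ((t • K + (1 - t) • L : ConvexBody (EuclideanSpace ℝ (Fin n))) :
        Set (EuclideanSpace ℝ (Fin n))) C
      = t * breadth s K C + (1 - t) * breadth s L C := by
  have hsupp : ∀ a, supportFn ((t • K + (1 - t) • L : ConvexBody (EuclideanSpace ℝ (Fin n))) :
      Set (EuclideanSpace ℝ (Fin n))) a = t * supportFn K a + (1 - t) * supportFn L a := by
    intro a
    rw [ConvexBody.coe_add, ConvexBody.coe_smul, ConvexBody.coe_smul,
      supportFn_add (K.isCompact.smul t) K.nonempty.smul_set (L.isCompact.smul _)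
        L.nonempty.smul_set,
      supportFn_smul_left K.isCompact K.nonempty ht.1,
      supportFn_smul_left L.isCompact L.nonempty (sub_nonneg.2 ht.2)]
  have hsub : ∀ M : ConvexBody (EuclideanSpace ℝ (Fin n)),
      supportFn (M - M : Set (EuclideanSpace ℝ (Fin n))) s = supportFn M s + supportFn M (-s) :=
    fun M => supportFn_sub M.isCompact M.nonempty M.isCompact M.nonempty
  unfold breadth
  rw [hsub, hsub K, hsub L, hsupp, hsupp]
  ring

/-- Width is affine on Minkowski segments that end in a body of constant width, since that body
contributes the same constant to the breadth in every direction. -/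
theorem width_combo_of_isConstantWidth (hn : 1 ≤ n)
    (hC : (interior (C : Set (EuclideanSpace ℝ (Fin n)))).Nonempty)
    (hL : IsConstantWidth L C) {t : ℝ} (ht : t ∈ Set.Icc (0 : ℝ) 1) :
    width ((t • K + (1 - t) • L : ConvexBody (EuclideanSpace ℝ (Fin n))) :
        Set (EuclideanSpace ℝ (Fin n))) C
      = t * width (K : Set (EuclideanSpace ℝ (Fin n))) C
        + (1 - t) * width (L : Set (EuclideanSpace ℝ (Fin n))) C := by
  have hbL : ∀ s ≠ 0, breadth s L C = width (L : Set (EuclideanSpace ℝ (Fin n))) C := fun s hs =>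
    le_antisymm ((breadth_le_diameter L C hC hs).trans_eq hL.symm) (width_le_breadth L C hs)
  apply le_antisymm
  · obtain ⟨s, hs, h⟩ := exists_breadth_eq_width K C hn hC
    rw [← h, ← hbL s hs, ← breadth_combo K L C ht]
    exact width_le_breadth _ C hs
  · obtain ⟨s, hs, h⟩ := exists_breadth_eq_width (t • K + (1 - t) • L) C hn hC
    rw [← h, breadth_combo K L C ht, hbL s hs]
    exact add_le_add_left (mul_le_mul_of_nonneg_left (width_le_breadth K C hs) ht.1) _

end Measures

/-! ### Dilates of the difference body -/

section DiffSupport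

variable (C : ConvexBody (EuclideanSpace ℝ (Fin n))) {d : ℝ}

/-- The support function of the dilated difference body `(d / 2) • (C - C)`. A convex body `K`
has diameter at most `d` exactly when the support function of `K - K` lies below it. -/
noncomputable def diffSupport (d : ℝ) (s : EuclideanSpace ℝ (Fin n)) : ℝ :=
  d / 2 * supportFn (C - C : Set (EuclideanSpace ℝ (Fin n))) s

theorem continuous_diffSupport : Continuous (diffSupport C d) :=
  continuous_const.mul (continuous_supportFn (isCompact_sub C.isCompact C.isCompact))

theorem diffSupport_neg (s : EuclideanSpace ℝ (Fin n)) :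
    diffSupport C d (-s) = diffSupport C d s := by
  unfold diffSupport
  rw [supportFn_sub_self_neg C.isCompact C.nonempty]

theorem diffSupport_smul {r : ℝ} (hr : 0 ≤ r) (s : EuclideanSpace ℝ (Fin n)) :
    diffSupport C d (r • s) = r * diffSupport C d s := by
  unfold diffSupport
  rw [supportFn_smul_right (isCompact_sub C.isCompact C.isCompact) (C.nonempty.sub C.nonempty) hr]
  ring

theorem diffSupport_pos (hC : (interior (C : Set (EuclideanSpace ℝ (Fin n)))).Nonempty)
    (hd : 0 < d) {s : EuclideanSpace ℝ (Fin n)} (hs : s ≠ 0) : 0 < diffSupport C d s :=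
  mul_pos (half_pos hd) (supportFn_sub_self_pos C hC hs)

/-- Every direction `s` is attained as an outer normal of `(d / 2) • (C - C)`. -/
theorem exists_inner_eq_diffSupport (hd : 0 ≤ d) (s : EuclideanSpace ℝ (Fin n)) :
    ∃ b, (∀ a, inner ℝ a b ≤ diffSupport C d a) ∧ inner ℝ s b = diffSupport C d s := by
  have hcpt := isCompact_sub C.isCompact C.isCompact
  obtain ⟨b, hb, h⟩ := exists_inner_eq_supportFn hcpt (C.nonempty.sub C.nonempty) s
  refine ⟨(d / 2) • b, fun a => ?_, ?_⟩
  · rw [real_inner_smul_right]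
    exact mul_le_mul_of_nonneg_left (inner_le_supportFn hcpt hb) (by positivity)
  · rw [real_inner_smul_right, h, diffSupport]

theorem exists_mul_norm_le_diffSupport
    (hC : (interior (C : Set (EuclideanSpace ℝ (Fin n)))).Nonempty) (hd : 0 < d) :
    ∃ m > 0, ∀ s, m * ‖s‖ ≤ diffSupport C d s := by
  obtain ⟨r, hr, hball⟩ := Metric.nhds_basis_closedBall.mem_iff.1 (sub_self_mem_nhds_zero C hC)
  refine ⟨d / 2 * r, by positivity, fun s => ?_⟩
  rw [diffSupport, mul_assoc]
  refine mul_le_mul_of_nonneg_left ?_ (by positivity)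
  by_cases hs : s = 0
  · simpa [hs] using supportFn_sub_self_nonneg (a := (0 : EuclideanSpace ℝ (Fin n)))
      C.isCompact C.nonempty
  have hs' : ‖s‖ ≠ 0 := norm_ne_zero_iff.2 hs
  have hmem : (r / ‖s‖) • s ∈ (C - C : Set (EuclideanSpace ℝ (Fin n))) := by
    refine hball ?_
    rw [mem_closedBall_zero_iff, norm_smul, norm_div, norm_norm, div_mul_cancel₀ _ hs',
      Real.norm_of_nonneg hr.le]
  have h := inner_le_supportFn (a := s) (isCompact_sub C.isCompact C.isCompact) hmem
  rw [real_inner_smul_right, real_inner_self_eq_norm_sq] at h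
  refine le_trans (le_of_eq ?_) h
  field_simp

theorem exists_diffSupport_le_mul_norm (hd : 0 ≤ d) :
    ∃ M > 0, ∀ s, diffSupport C d s ≤ M * ‖s‖ := by
  obtain ⟨M, hM, hbd⟩ :=
    (isCompact_sub C.isCompact C.isCompact).isBounded.exists_pos_norm_le
  refine ⟨d / 2 * M + 1, by positivity, fun s => ?_⟩
  have h : supportFn (C - C : Set (EuclideanSpace ℝ (Fin n))) s ≤ ‖s‖ * M :=
    supportFn_le (C.nonempty.sub C.nonempty) fun x hx =>
      (real_inner_le_norm s x).trans (mul_le_mul_of_nonneg_left (hbd x hx) (norm_nonneg s))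
  rw [diffSupport]
  nlinarith [mul_le_mul_of_nonneg_left h (div_nonneg hd zero_le_two), norm_nonneg s]

theorem isCompact_diffSupport_eq_one
    (hC : (interior (C : Set (EuclideanSpace ℝ (Fin n)))).Nonempty) (hd : 0 < d) :
    IsCompact {s | diffSupport C d s = 1} := by
  obtain ⟨m, hm, hle⟩ := exists_mul_norm_le_diffSupport C hC hd
  refine (isCompact_closedBall (0 : EuclideanSpace ℝ (Fin n)) m⁻¹).of_isClosed_subset
    (isClosed_eq (continuous_diffSupport C) continuous_const) fun s hs => ?_
  rw [mem_closedBall_zero_iff, ← one_div, le_div_iff₀' hm]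
  exact (hle s).trans_eq hs

theorem diffSupport_inv_smul (hC : (interior (C : Set (EuclideanSpace ℝ (Fin n)))).Nonempty)
    (hd : 0 < d) {s : EuclideanSpace ℝ (Fin n)} (hs : s ≠ 0) :
    diffSupport C d ((diffSupport C d s)⁻¹ • s) = 1 := by
  have h := diffSupport_pos C hC hd hs
  rw [diffSupport_smul C (inv_pos.2 h).le, inv_mul_cancel₀ h.ne']

theorem ne_zero_of_diffSupport_eq_one {s : EuclideanSpace ℝ (Fin n)}
    (hs : diffSupport C d s = 1) : s ≠ 0 := by
  rintro rfl
  have h := diffSupport_smul C (d := d) le_rfl (0 : EuclideanSpace ℝ (Fin n))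
  rw [zero_smul, hs] at h
  norm_num at h

theorem breadth_eq_of_diffSupport_eq_one (K : ConvexBody (EuclideanSpace ℝ (Fin n)))
    {s : EuclideanSpace ℝ (Fin n)} (hs : diffSupport C d s = 1) :
    breadth s K C = d * supportFn (K - K : Set (EuclideanSpace ℝ (Fin n))) s := by
  rw [diffSupport] at hs
  have hne : supportFn (C - C : Set (EuclideanSpace ℝ (Fin n))) s ≠ 0 := by
    intro h
    simp [h] at hs
  rw [breadth, div_eq_iff hne]
  linear_combination (-2 * supportFn (K - K : Set (EuclideanSpace ℝ (Fin n))) s) * hs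

/-- A convex body containing a truncation of a translate of the ball with support function
`ρ • diffSupport C d`, cut in direction `s` so that its extent in that direction drops from `2ρ` to
`2ρ - δ`, is strictly longer than `2ρ - δ` in all other directions. -/
theorem lt_supportFn_of_truncated_ball (M : ConvexBody (EuclideanSpace ℝ (Fin n)))
    (hC : (interior (C : Set (EuclideanSpace ℝ (Fin n)))).Nonempty) (hd : 0 < d)
    {c s v : EuclideanSpace ℝ (Fin n)} {ρ δ : ℝ} (hδ : 0 < δ) (hδρ : δ ≤ ρ)
    (hM : ∀ b, (∀ a, inner ℝ a b ≤ ρ * diffSupport C d a) → inner ℝ s b ≤ ρ - δ → c + b ∈ M)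
    (hs : diffSupport C d s = 1) (hv : diffSupport C d v = 1) (hvs : v ≠ s) (hvs' : v ≠ -s) :
    2 * ρ - δ < supportFn (M - M : Set (EuclideanSpace ℝ (Fin n))) v := by
  obtain ⟨m, hm, hmle⟩ := exists_mul_norm_le_diffSupport C hC hd
  have hs0 := ne_zero_of_diffSupport_eq_one C hs
  have key : ∀ v b : EuclideanSpace ℝ (Fin n), diffSupport C d v = 1 → v ≠ s → v ≠ -s →
      (∀ a, inner ℝ a b ≤ diffSupport C d a) → inner ℝ v b = 1 → 0 ≤ inner ℝ s b →
      2 * ρ - δ < supportFn (M - M : Set (EuclideanSpace ℝ (Fin n))) v := by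
    intro v b hv hvs hvs' hb hvb hsb
    -- `e` is a positive multiple of the component of `v` orthogonal to `s`
    set e := ‖s‖ ^ 2 • v - (inner ℝ s v : ℝ) • s with he
    have hse : inner ℝ s e = (0 : ℝ) := by
      rw [he, inner_sub_right, real_inner_smul_right, real_inner_smul_right,
        real_inner_self_eq_norm_sq]
      ring
    have he0 : e ≠ 0 := by
      intro h
      have hn : ‖s‖ ^ 2 ≠ 0 := pow_ne_zero 2 (norm_ne_zero_iff.2 hs0)
      obtain ⟨r, hr⟩ : ∃ r : ℝ, v = r • s := by
        refine ⟨(‖s‖ ^ 2)⁻¹ * inner ℝ s v, ?_⟩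
        rw [mul_smul, ← sub_eq_zero.1 h, smul_smul, inv_mul_cancel₀ hn, one_smul]
      rcases le_total 0 r with h0 | h0
      · have h1 := diffSupport_smul C (d := d) h0 s
        rw [← hr, hv, hs, mul_one] at h1
        exact hvs (by rw [hr, ← h1, one_smul])
      · have h1 := diffSupport_smul C (d := d) (neg_nonneg.2 h0) s
        rw [neg_smul, ← hr, diffSupport_neg, hv, hs, mul_one] at h1
        exact hvs' (by rw [hr, neg_eq_iff_eq_neg.1 h1.symm, neg_smul, one_smul])
    have hve : 0 < (inner ℝ v e : ℝ) := by
      have h1 : (inner ℝ e e : ℝ) = ‖s‖ ^ 2 * inner ℝ v e := by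
        conv_lhs => rw [he, ← he, inner_sub_left, real_inner_smul_left, real_inner_smul_left, hse]
        ring
      have h2 := real_inner_self_pos.2 he0
      rw [h1] at h2
      exact (mul_pos_iff_of_pos_left (by positivity)).1 h2
    have hnorm : 0 < ‖e‖ := norm_pos_iff.2 he0
    set ε := δ * m / ‖e‖ with hε
    have hε0 : 0 < ε := by positivity
    have h1 : c + ((ρ - δ) • b + ε • e) ∈ M := by
      refine hM _ (fun a => ?_) ?_
      · have hae : inner ℝ a (ε • e) ≤ δ * diffSupport C d a := by
          rw [real_inner_smul_right]
          calc ε * inner ℝ a e ≤ ε * (‖a‖ * ‖e‖) :=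
                mul_le_mul_of_nonneg_left (real_inner_le_norm a e) hε0.le
            _ = δ * (m * ‖a‖) := by rw [hε]; field_simp
            _ ≤ δ * diffSupport C d a := mul_le_mul_of_nonneg_left (hmle a) hδ.le
        have hab := mul_le_mul_of_nonneg_left (hb a) (sub_nonneg.2 hδρ)
        rw [inner_add_right, real_inner_smul_right]
        linarith
      · have hsb1 : inner ℝ s b ≤ 1 := hs ▸ hb s
        rw [inner_add_right, real_inner_smul_right, real_inner_smul_right, hse]
        nlinarith
    have h2 : c + -(ρ • b) ∈ M := by
      refine hM _ (fun a => ?_) ?_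
      · have h := mul_le_mul_of_nonneg_left (hb (-a)) (hδ.le.trans hδρ)
        rw [diffSupport_neg, inner_neg_left] at h
        rw [inner_neg_right, real_inner_smul_right]
        linarith
      · rw [inner_neg_right, real_inner_smul_right]
        nlinarith
    have h3 := inner_le_supportFn (a := v) (isCompact_sub M.isCompact M.isCompact)
      (Set.sub_mem_sub h1 h2)
    rw [add_sub_add_left_eq_sub, inner_sub_right, inner_add_right, inner_neg_right,
      real_inner_smul_right, real_inner_smul_right, real_inner_smul_right, hvb] at h3
    nlinarith [mul_pos hε0 hve]
  obtain ⟨b, hb, hvb⟩ := exists_inner_eq_diffSupport C hd.le v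
  rw [hv] at hvb
  rcases le_total 0 (inner ℝ s b : ℝ) with h | h
  · exact key v b hv hvs hvs' hb hvb h
  · rw [← supportFn_sub_self_neg M.isCompact M.nonempty]
    refine key (-v) (-b) (by rw [diffSupport_neg, hv]) (fun h' => hvs' (neg_eq_iff_eq_neg.1 h'))
      (fun h' => hvs (neg_injective h')) (fun a => ?_) (by rw [inner_neg_neg, hvb])
      (by rw [inner_neg_right]; linarith)
    have h := hb (-a)
    rwa [diffSupport_neg, inner_neg_left, ← inner_neg_right] at h

end DiffSupport

/-! ### Complete bodies -/

section Complete

variable {K C : ConvexBody (EuclideanSpace ℝ (Fin n))}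

/-- The spherical intersection property of complete bodies: a point at distance at most the
diameter from every point of `K` belongs to `K`, since adjoining it does not enlarge the
diameter. -/
theorem IsCompleteBody.mem_of_inner_sub_le (hK : IsCompleteBody K C)
    (hC : (interior (C : Set (EuclideanSpace ℝ (Fin n)))).Nonempty)
    {p : EuclideanSpace ℝ (Fin n)}
    (hp : ∀ q ∈ K, ∀ s, inner ℝ s (p - q)
      ≤ diffSupport C (diameter (K : Set (EuclideanSpace ℝ (Fin n))) C) s) : p ∈ K := by
  set d := diameter (K : Set (EuclideanSpace ℝ (Fin n))) C with hd
  have hd0 : 0 ≤ d := diameter_nonneg _ _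
  by_contra hpK
  let K' : ConvexBody (EuclideanSpace ℝ (Fin n)) :=
    ⟨convexHull ℝ (insert p K), convex_convexHull ℝ _,
      isCompact_convexHull_of_isCompact (K.isCompact.insert p),
      (Set.insert_nonempty p _).convexHull⟩
  have hsub : insert p (K : Set (EuclideanSpace ℝ (Fin n))) ⊆ K' := subset_convexHull ℝ _
  have hlt := hK K' ⟨(Set.subset_insert p _).trans hsub, fun h => hpK (h (hsub (by simp)))⟩
  refine absurd hlt (not_lt.2 ((diameter_le_iff K' C hC hd0).2 fun s => ?_))
  have hdiff : ∀ x ∈ insert p (K : Set (EuclideanSpace ℝ (Fin n))),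
      ∀ y ∈ insert p (K : Set (EuclideanSpace ℝ (Fin n))),
      inner ℝ s (x - y) ≤ diffSupport C d s := by
    rintro x (rfl | hx) y (rfl | hy)
    · rw [sub_self, inner_zero_right]
      exact mul_nonneg (by positivity) (supportFn_sub_self_nonneg C.isCompact C.nonempty)
    · exact hp y hy s
    · have h := hp x hx (-s)
      rwa [diffSupport_neg, inner_neg_left, ← inner_neg_right, neg_sub] at h
    · have h := (diameter_le_iff K C hC hd0).1 le_rfl s
      have h1 := inner_le_supportFn (a := s) (isCompact_sub K.isCompact K.isCompact)
        (Set.sub_mem_sub hx hy)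
      rw [diffSupport]
      linarith
  have hconv : ∀ z : ℝ, ∀ a : EuclideanSpace ℝ (Fin n),
      Convex ℝ {x : EuclideanSpace ℝ (Fin n) | inner ℝ a x ≤ z} := fun z a =>
    convex_halfSpace_le (innerSL ℝ a).isLinear z
  have hhull : ∀ x ∈ K', ∀ y ∈ K', inner ℝ s (x - y) ≤ diffSupport C d s := by
    intro x hx y hy
    have h1 : ∀ y ∈ insert p (K : Set (EuclideanSpace ℝ (Fin n))),
        inner ℝ s x ≤ diffSupport C d s + inner ℝ s y := fun y hy =>
      convexHull_min (fun x hx => by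
        have h := hdiff x hx y hy
        rw [inner_sub_right] at h
        show inner ℝ s x ≤ _
        linarith) (hconv (diffSupport C d s + inner ℝ s y) s) hx
    have h2 : inner ℝ (-s) y ≤ diffSupport C d s - inner ℝ s x :=
      convexHull_min (fun y hy => by
        have h := h1 y hy
        show inner ℝ (-s) y ≤ _
        rw [inner_neg_left]
        linarith) (hconv (diffSupport C d s - inner ℝ s x) (-s)) hy
    rw [inner_neg_left] at h2
    rw [inner_sub_right]
    linarith
  have h : supportFn (K' - K' : Set (EuclideanSpace ℝ (Fin n))) s ≤ diffSupport C d s := by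
    refine supportFn_le (K'.nonempty.sub K'.nonempty) ?_
    rintro _ ⟨x, hx, y, hy, rfl⟩
    exact hhull x hx y hy
  rw [diffSupport] at h
  linarith

/-- If `K` lies in the ball `c + R • B`, where `B` has support function `diffSupport C d` with `d`
the diameter of the complete body `K`, then `K` contains the concentric ball
`c + (1 - R) • B`. -/
theorem IsCompleteBody.add_mem (hK : IsCompleteBody K C)
    (hC : (interior (C : Set (EuclideanSpace ℝ (Fin n)))).Nonempty)
    {c : EuclideanSpace ℝ (Fin n)} {R : ℝ}
    (hR : ∀ q ∈ K, ∀ s, inner ℝ s (q - c)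
      ≤ R * diffSupport C (diameter (K : Set (EuclideanSpace ℝ (Fin n))) C) s)
    {b : EuclideanSpace ℝ (Fin n)}
    (hb : ∀ s, inner ℝ s b
      ≤ (1 - R) * diffSupport C (diameter (K : Set (EuclideanSpace ℝ (Fin n))) C) s) :
    c + b ∈ K := by
  refine hK.mem_of_inner_sub_le hC fun q hq s => ?_
  have h := hR q hq (-s)
  rw [diffSupport_neg, inner_neg_left, ← inner_neg_right, neg_sub] at h
  have h2 : c + b - q = c - q + b := by abel
  rw [h2, inner_add_right]
  linarith [hb s]

end Complete

/-! ### Circumscribed balls -/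

/-- For a compact set `S` of directions and offsets `k`, consider the least `R` for which the
constraints `k s - ⟪s, c⟫ ≤ R` on the centre `c` are solvable. The condition `hspan` makes this a
coercive problem, so the least `R` is attained, and then the origin is a convex combination of the
directions of the active constraints: otherwise a separating direction would improve the centre. -/
theorem exists_optimal_center {E : Type*} [NormedAddCommGroup E] [InnerProductSpace ℝ E]
    [FiniteDimensional ℝ E] {S : Set E} (hS : IsCompact S) (hne : S.Nonempty) {k : E → ℝ}
    (hk : Continuous k) {m : ℝ} (hm : 0 < m)
    (hspan : ∀ c, ∃ s ∈ S, m * ‖c‖ ≤ -inner ℝ s c) :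
    ∃ (c : E) (R : ℝ), (∀ s ∈ S, k s - inner ℝ s c ≤ R) ∧
      (0 : E) ∈ convexHull ℝ {s ∈ S | k s - inner ℝ s c = R} := by
  set Φ : E → ℝ := fun c => sSup ((fun s => k s - inner ℝ s c) '' S) with hΦ
  have hbdd : ∀ c, BddAbove ((fun s => k s - inner ℝ s c) '' S) := fun c =>
    (hS.image (by fun_prop)).bddAbove
  have hle : ∀ c, ∀ s ∈ S, k s - inner ℝ s c ≤ Φ c := fun c s hs => le_csSup (hbdd c) ⟨s, hs, rfl⟩
  have hatt : ∀ c, ∃ s ∈ S, k s - inner ℝ s c = Φ c := fun c => by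
    obtain ⟨s, hs, h⟩ := (hS.image (f := fun s => k s - inner ℝ s c) (by fun_prop)).sSup_mem
      (hne.image _)
    exact ⟨s, hs, h⟩
  have hΦc : Continuous Φ :=
    hS.continuous_sSup (f := fun c s => k s - inner ℝ s c)
      ((hk.comp continuous_snd).sub (continuous_snd.inner continuous_fst))
  obtain ⟨s₀, hs₀, hmin⟩ := hS.exists_isMinOn hne hk.continuousOn
  have hcoer : Filter.Tendsto Φ (Filter.cocompact E) Filter.atTop := by
    refine Filter.tendsto_atTop_mono (f := fun c => m * ‖c‖ + k s₀) (fun c => ?_)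
      (Filter.tendsto_atTop_add_const_right _ _
        (Filter.Tendsto.const_mul_atTop hm (tendsto_norm_cocompact_atTop (E := E))))
    obtain ⟨s, hs, h⟩ := hspan c
    have h1 : k s₀ ≤ k s := hmin hs
    linarith [hle c s hs]
  obtain ⟨c, hc⟩ := hΦc.exists_forall_le hcoer
  refine ⟨c, Φ c, hle c, ?_⟩
  by_contra h0
  have hact : IsCompact {s ∈ S | k s - inner ℝ s c = Φ c} :=
    hS.inter_right (isClosed_eq (by fun_prop) continuous_const)
  obtain ⟨f, u, hf0, hfu⟩ := geometric_hahn_banach_point_closed (convex_convexHull ℝ _)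
    (isCompact_convexHull_of_isCompact hact).isClosed h0
  -- moving the centre in the separating direction `g` relaxes every active constraint
  set g := (InnerProductSpace.toDual ℝ E).symm f with hg
  have hrep : ∀ y, inner ℝ y g = f y := fun y => by
    rw [real_inner_comm]
    exact InnerProductSpace.toDual_symm_apply
  have hgpos : ∀ s ∈ S, k s - inner ℝ s c = Φ c → 0 < (inner ℝ s g : ℝ) := fun s hs h => by
    rw [hrep]
    rw [map_zero] at hf0
    exact hf0.trans (hfu s (subset_convexHull ℝ _ ⟨hs, h⟩))
  set T := S ∩ {s | inner ℝ s g ≤ (0 : ℝ)} with hT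
  have hTc : IsCompact T := hS.inter_right (isClosed_le (by fun_prop) continuous_const)
  obtain ⟨B, hB, hBd⟩ : ∃ B > 0, ∀ s ∈ S, -(inner ℝ s g : ℝ) ≤ B := by
    obtain ⟨B, hB⟩ := (hS.image (f := fun s => -(inner ℝ s g : ℝ)) (by fun_prop)).bddAbove
    exact ⟨max B 1, by positivity, fun s hs => (hB ⟨s, hs, rfl⟩).trans (le_max_left _ _)⟩
  -- the remaining constraints have slack bounded below by some `η`
  obtain ⟨η, hη, hηT⟩ : ∃ η > 0, ∀ s ∈ T, k s - inner ℝ s c ≤ Φ c - η := by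
    rcases T.eq_empty_or_nonempty with hTe | hTne
    · exact ⟨1, one_pos, by simp [hTe]⟩
    · obtain ⟨t, ht, hmax⟩ := hTc.exists_isMaxOn hTne
        (f := fun s => k s - inner ℝ s c) (by fun_prop)
      refine ⟨Φ c - (k t - inner ℝ t c), ?_, fun s hs => ?_⟩
      · refine sub_pos.2 (lt_of_le_of_ne (hle c t ht.1) fun h => ?_)
        exact absurd (hgpos t ht.1 h) (not_lt.2 ht.2)
      · have h : k s - inner ℝ s c ≤ k t - inner ℝ t c := hmax hs
        linarith
  set ε := η / (2 * B) with hε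
  have hε0 : 0 < ε := by positivity
  have hεB : ε * B = η / 2 := by rw [hε]; field_simp
  obtain ⟨s, hs, hsΦ⟩ := hatt (c + ε • g)
  have hmin' := hc (c + ε • g)
  rw [← hsΦ, inner_add_right, real_inner_smul_right] at hmin'
  by_cases hsg : (inner ℝ s g : ℝ) ≤ 0
  · nlinarith [hηT s ⟨hs, hsg⟩, mul_le_mul_of_nonneg_left (hBd s hs) hε0.le]
  · nlinarith [hle c s hs, mul_pos hε0 (not_le.1 hsg)]

/-- If the origin lies in the convex hull of `Γ`, then some `i ∈ Γ` (any one with positive weight)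
has the property that a vector with positive component along `i` has a negative component along
another element of `Γ`. -/
theorem exists_inner_neg_of_zero_mem_convexHull {E : Type*} [NormedAddCommGroup E]
    [InnerProductSpace ℝ E] {Γ : Set E} (h : (0 : E) ∈ convexHull ℝ Γ) :
    ∃ i ∈ Γ, ∀ p, 0 < (inner ℝ i p : ℝ) → ∃ j ∈ Γ, (inner ℝ j p : ℝ) < 0 := by
  obtain ⟨ι, _, w, z, hw, hw1, hz, hsum⟩ := mem_convexHull_iff_exists_fintype.1 h
  obtain ⟨i, -, hi⟩ : ∃ i ∈ Finset.univ, 0 < w i := by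
    by_contra! hneg
    linarith [Finset.sum_nonpos hneg]
  refine ⟨z i, hz i, fun p hp => ?_⟩
  by_contra! hneg
  have h1 : ∑ j, w j * inner ℝ (z j) p = 0 := by
    have h2 := congrArg (fun x => (inner ℝ x p : ℝ)) hsum
    simpa [sum_inner, real_inner_smul_left] using h2
  have h2 : 0 < ∑ j, w j * inner ℝ (z j) p :=
    Finset.sum_pos' (fun j _ => mul_nonneg (hw j) (hneg _ (hz j)))
      ⟨i, Finset.mem_univ i, mul_pos hi hp⟩
  exact h2.ne' h1

/-! ### Cutting a complete body that is not of constant width -/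

section Slab

variable {K C : ConvexBody (EuclideanSpace ℝ (Fin n))}

/-- Existence of a circumscribed ball of a convex body with respect to the difference body, with
the optimality condition: the origin is a convex combination of the normals of its contacts. -/
theorem exists_circumscribed_ball (K : ConvexBody (EuclideanSpace ℝ (Fin n))) (hn : 1 ≤ n)
    (hC : (interior (C : Set (EuclideanSpace ℝ (Fin n)))).Nonempty) {d : ℝ} (hd : 0 < d) :
    ∃ (c : EuclideanSpace ℝ (Fin n)) (R : ℝ),
      (∀ q ∈ K, ∀ s, inner ℝ s (q - c) ≤ R * diffSupport C d s) ∧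
      (0 : EuclideanSpace ℝ (Fin n)) ∈
        convexHull ℝ {s | diffSupport C d s = 1 ∧ ∃ y ∈ K, inner ℝ s (y - c) = R} := by
  have : Nonempty (Fin n) := ⟨⟨0, hn⟩⟩
  obtain ⟨x₀, hx₀⟩ := exists_ne (0 : EuclideanSpace ℝ (Fin n))
  obtain ⟨M, hM, hMle⟩ := exists_diffSupport_le_mul_norm C hd.le
  have hne : {s | diffSupport C d s = 1}.Nonempty := ⟨_, diffSupport_inv_smul C hC hd hx₀⟩
  obtain ⟨c, R, hR, h0⟩ := exists_optimal_center (isCompact_diffSupport_eq_one C hC hd) hne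
    (continuous_supportFn K.isCompact) (inv_pos.2 hM) fun c => by
      by_cases hc : c = 0
      · obtain ⟨s, hs⟩ := hne
        exact ⟨s, hs, by simp [hc]⟩
      · have hpos := diffSupport_pos C hC hd hc
        refine ⟨-((diffSupport C d c)⁻¹ • c), ?_, ?_⟩
        · show diffSupport C d _ = 1
          rw [diffSupport_neg, diffSupport_inv_smul C hC hd hc]
        · have hnorm : 0 < ‖c‖ := norm_pos_iff.2 hc
          rw [inner_neg_left, neg_neg, real_inner_smul_left, real_inner_self_eq_norm_sq,
            inv_mul_eq_div, inv_mul_eq_div, div_le_div_iff₀ hM hpos]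
          nlinarith [hMle c]
  refine ⟨c, R, fun q hq s => ?_, ?_⟩
  · by_cases hs : s = 0
    · have h := diffSupport_smul C (d := d) le_rfl (0 : EuclideanSpace ℝ (Fin n))
      rw [zero_smul, zero_mul] at h
      simp [hs, h]
    · have hpos := diffSupport_pos C hC hd hs
      have h1 := hR _ (diffSupport_inv_smul C hC hd hs)
      have h2 := inner_le_supportFn (a := (diffSupport C d s)⁻¹ • s) K.isCompact hq
      have h3 : inner ℝ ((diffSupport C d s)⁻¹ • s) (q - c) ≤ R := by
        rw [inner_sub_right]
        linarith
      rwa [real_inner_smul_left, inv_mul_eq_div, div_le_iff₀ hpos] at h3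
  · refine convexHull_mono ?_ h0
    rintro s ⟨hs, hsR⟩
    obtain ⟨y, hy, h⟩ := exists_inner_eq_supportFn K.isCompact K.nonempty s
    exact ⟨hs, y, hy, by rw [inner_sub_right, h, hsR]⟩

/-- If the circumscribed ball of a complete body has radius at most half the diameter, then the
concentric inscribed ball forces constant width. -/
theorem IsCompleteBody.diameter_le_width (hK : IsCompleteBody K C) (hn : 1 ≤ n)
    (hC : (interior (C : Set (EuclideanSpace ℝ (Fin n)))).Nonempty)
    (hd : 0 < diameter (K : Set (EuclideanSpace ℝ (Fin n))) C)
    {c : EuclideanSpace ℝ (Fin n)} {R : ℝ} (hR2 : R ≤ 1 / 2)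
    (hR : ∀ q ∈ K, ∀ s, inner ℝ s (q - c)
      ≤ R * diffSupport C (diameter (K : Set (EuclideanSpace ℝ (Fin n))) C) s) :
    diameter (K : Set (EuclideanSpace ℝ (Fin n))) C
      ≤ width (K : Set (EuclideanSpace ℝ (Fin n))) C := by
  set d := diameter (K : Set (EuclideanSpace ℝ (Fin n))) C
  obtain ⟨s, hs, h⟩ := exists_breadth_eq_width K C hn hC
  rw [← h, ← breadth_smul K C (inv_pos.2 (diffSupport_pos C hC hd hs))]
  have hs1 := diffSupport_inv_smul C hC hd hs
  set t := (diffSupport C d s)⁻¹ • s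
  rw [breadth_eq_of_diffSupport_eq_one C K hs1]
  obtain ⟨b, hb, hsb⟩ := exists_inner_eq_diffSupport C hd.le t
  have hmem : ∀ e : EuclideanSpace ℝ (Fin n), (∀ a, inner ℝ a e ≤ diffSupport C d a) →
      c + (1 - R) • e ∈ K := fun e he => hK.add_mem hC hR fun a => by
    rw [real_inner_smul_right]
    exact mul_le_mul_of_nonneg_left (he a) (by linarith)
  have hb' : ∀ a, inner ℝ a (-b) ≤ diffSupport C d a := fun a => by
    have h := hb (-a)
    rwa [diffSupport_neg, inner_neg_left, ← inner_neg_right] at h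
  have h1 := inner_le_supportFn (a := t) (isCompact_sub K.isCompact K.isCompact)
    (Set.sub_mem_sub (hmem b hb) (hmem (-b) hb'))
  rw [add_sub_add_left_eq_sub, inner_sub_right, real_inner_smul_right, real_inner_smul_right,
    inner_neg_right, hsb, hs1] at h1
  nlinarith

/-- A complete body that is not of constant width can be cut by a half-space, without decreasing
its diameter, so that the width of the remaining body is attained only in the normal direction `s`
of the cut, in which the original body has maximal breadth.

The direction `s` is a contact normal of the circumscribed ball. The cut goes through the concentric
inscribed ball just below its top in direction `s`, low enough to beat the width of that ball and
high enough to keep a diametral pair whose members both lie below that top. -/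
theorem IsCompleteBody.exists_cut (hK : IsCompleteBody K C) (hn : 1 ≤ n)
    (hC : (interior (C : Set (EuclideanSpace ℝ (Fin n)))).Nonempty)
    (hw : width (K : Set (EuclideanSpace ℝ (Fin n))) C
      < diameter (K : Set (EuclideanSpace ℝ (Fin n))) C) :
    ∃ (M : ConvexBody (EuclideanSpace ℝ (Fin n))) (s : EuclideanSpace ℝ (Fin n)),
      IsCompletionOf K M C ∧
      breadth s K C = diameter (K : Set (EuclideanSpace ℝ (Fin n))) C ∧
      ∀ v : EuclideanSpace ℝ (Fin n), v ≠ 0 → breadth v M C = width (M : Set (EuclideanSpace ℝ (Fin n))) C →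
        breadth v K C = breadth s K C := by
  set d := diameter (K : Set (EuclideanSpace ℝ (Fin n))) C with hd_def
  have hd : 0 < d := by
    obtain ⟨s, -, h⟩ := exists_breadth_eq_width K C hn hC
    exact (h ▸ breadth_nonneg K C s).trans_lt hw
  have hdiam := (diameter_le_iff K C hC hd.le).1 le_rfl
  obtain ⟨c, R, hR, h0⟩ := exists_circumscribed_ball K hn hC hd
  have hR2 : 1 / 2 < R := by
    by_contra! h
    exact absurd (hK.diameter_le_width hn hC hd h hR) (not_le.2 hw)
  have hball : ∀ b, (∀ a, inner ℝ a b ≤ (1 - R) * diffSupport C d a) → c + b ∈ K := fun b hb =>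
    hK.add_mem hC hR hb
  -- opposite to a contact normal of the circumscribed ball, `K` extends by at most `1 - R`, since
  -- it extends by `R` along that normal and its diameter is `d`
  have hlow : ∀ s, diffSupport C d s = 1 → (∃ y ∈ K, inner ℝ s (y - c) = R) →
      ∀ q ∈ K, inner ℝ s (c - q) ≤ 1 - R := by
    rintro s hs ⟨y, hy, hyR⟩ q hq
    have h1 := inner_le_supportFn (a := s) (isCompact_sub K.isCompact K.isCompact)
      (Set.sub_mem_sub hy hq)
    have h2 := hdiam s
    rw [diffSupport] at hs
    have h3 : inner ℝ s (y - q) = inner ℝ s (y - c) + inner ℝ s (c - q) := by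
      rw [← inner_add_right, sub_add_sub_cancel]
    linarith
  obtain ⟨i, ⟨hi1, y, hy, hyR⟩, hi⟩ := exists_inner_neg_of_zero_mem_convexHull h0
  have hR1 : R < 1 := by
    obtain ⟨j, ⟨hj1, hj⟩, hneg⟩ := hi (y - c) (by rw [hyR]; linarith)
    have h := hlow j hj1 hj y hy
    rw [← neg_sub, inner_neg_right] at h
    linarith
  -- `c - (1 - R) • b` and `y` form a diametral pair with normal `i`
  obtain ⟨b, hb, hib⟩ := exists_inner_eq_diffSupport C hd.le i
  rw [hi1] at hib
  have hx : c + -((1 - R) • b) ∈ K := hball _ fun a => by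
    have h := mul_le_mul_of_nonneg_left (hb (-a)) (sub_nonneg.2 hR1.le)
    rw [diffSupport_neg, inner_neg_left] at h
    rw [inner_neg_right, real_inner_smul_right]
    linarith
  set x := c + -((1 - R) • b) with hx_def
  have hix : inner ℝ i (x - c) = -(1 - R) := by
    rw [hx_def, add_sub_cancel_left, inner_neg_right, real_inner_smul_right, hib, mul_one]
  obtain ⟨s, ⟨hs1, hsK⟩, hsneg⟩ := hi ((x - c) + (y - c)) (by
    rw [inner_add_right, hix, hyR]
    linarith)
  have hflip : ∀ q, inner ℝ s (c - q) = -inner ℝ s (q - c) := fun q => by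
    rw [← neg_sub, inner_neg_right]
  have hsx := hlow s hs1 hsK x hx
  have hsy := hlow s hs1 hsK y hy
  rw [hflip] at hsx hsy
  rw [inner_add_right] at hsneg
  obtain ⟨δ, hδ, hδR, hδx, hδy⟩ : ∃ δ > 0, δ ≤ 1 - R ∧
      inner ℝ s (x - c) ≤ 1 - R - δ ∧ inner ℝ s (y - c) ≤ 1 - R - δ := by
    refine ⟨min (1 - R) (min (1 - R - inner ℝ s (x - c)) (1 - R - inner ℝ s (y - c))), ?_,
      min_le_left _ _, ?_, ?_⟩
    · exact lt_min (by linarith) (lt_min (by linarith) (by linarith))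
    · linarith [(min_le_right (1 - R) _).trans (min_le_left (1 - R - inner ℝ s (x - c))
        (1 - R - inner ℝ s (y - c)))]
    · linarith [(min_le_right (1 - R) _).trans (min_le_right (1 - R - inner ℝ s (x - c))
        (1 - R - inner ℝ s (y - c)))]
  let M : ConvexBody (EuclideanSpace ℝ (Fin n)) :=
    { carrier := K ∩ {q | inner ℝ s q ≤ inner ℝ s c + (1 - R - δ)}
      convex' := K.convex.inter (convex_halfSpace_le (innerSL ℝ s).isLinear _)
      isCompact' := K.isCompact.inter_right (isClosed_le (by fun_prop) continuous_const)
      nonempty' := ⟨x, hx, by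
        rw [inner_sub_right] at hδx
        show inner ℝ s x ≤ _
        linarith⟩ }
  have hM : ∀ q, q ∈ M ↔ q ∈ K ∧ inner ℝ s (q - c) ≤ 1 - R - δ := fun q => by
    rw [inner_sub_right, sub_le_iff_le_add']
    rfl
  have hMK : (M : Set (EuclideanSpace ℝ (Fin n))) ⊆ K := fun q hq => hq.1
  have hMdiam : diameter (M : Set (EuclideanSpace ℝ (Fin n))) C = d := by
    apply le_antisymm
    · refine (diameter_le_iff M C hC hd.le).2 fun a => le_trans ?_ (hdiam a)
      refine mul_le_mul_of_nonneg_left (supportFn_le (M.nonempty.sub M.nonempty) fun z hz => ?_)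
        zero_le_two
      exact inner_le_supportFn (isCompact_sub K.isCompact K.isCompact) (Set.sub_subset_sub hMK hMK hz)
    · have h1 := (diameter_le_iff M C hC (diameter_nonneg _ _)).1 le_rfl i
      have h2 := inner_le_supportFn (a := i) (isCompact_sub M.isCompact M.isCompact)
        (Set.sub_mem_sub ((hM y).2 ⟨hy, hδy⟩) ((hM x).2 ⟨hx, hδx⟩))
      rw [← sub_sub_sub_cancel_right y x c, inner_sub_right, hyR, hix] at h2
      have hpos := supportFn_sub_self_pos C hC (ne_zero_of_diffSupport_eq_one C hi1)
      rw [diffSupport] at hi1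
      refine le_of_mul_le_mul_right ?_ hpos
      linarith
  have hMs : supportFn (M - M : Set (EuclideanSpace ℝ (Fin n))) s ≤ 2 * (1 - R) - δ := by
    refine supportFn_le (M.nonempty.sub M.nonempty) ?_
    rintro _ ⟨p, hp, q, hq, rfl⟩
    have h1 := ((hM p).1 hp).2
    have h2 := hlow s hs1 hsK q (hMK hq)
    have h3 : inner ℝ s (p - q) = inner ℝ s (p - c) + inner ℝ s (c - q) := by
      rw [← inner_add_right, sub_add_sub_cancel]
    show inner ℝ s (p - q) ≤ _
    linarith
  have hs0 := ne_zero_of_diffSupport_eq_one C hs1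
  refine ⟨M, s, ⟨hMK, hMdiam, hK⟩, le_antisymm (breadth_le_diameter K C hC hs0) ?_, ?_⟩
  · -- the contact of the circumscribed ball and the opposite point of the inscribed ball
    obtain ⟨z, hz, hzR⟩ := hsK
    obtain ⟨e, he, hse⟩ := exists_inner_eq_diffSupport C hd.le s
    have hmem : c + -((1 - R) • e) ∈ K := hball _ fun a => by
      have h := mul_le_mul_of_nonneg_left (he (-a)) (sub_nonneg.2 hR1.le)
      rw [diffSupport_neg, inner_neg_left] at h
      rw [inner_neg_right, real_inner_smul_right]
      linarith
    have h1 := inner_le_supportFn (a := s) (isCompact_sub K.isCompact K.isCompact)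
      (Set.sub_mem_sub hz hmem)
    rw [← sub_sub, inner_sub_right, hzR, inner_neg_right, real_inner_smul_right, hse, hs1] at h1
    rw [breadth_eq_of_diffSupport_eq_one C K hs1]
    nlinarith
  · intro v hv hvM
    rw [← breadth_smul M C (inv_pos.2 (diffSupport_pos C hC hd hv))] at hvM
    rw [← breadth_smul K C (inv_pos.2 (diffSupport_pos C hC hd hv))]
    have hv1 := diffSupport_inv_smul C hC hd hv
    set t := (diffSupport C d v)⁻¹ • v
    by_cases hts : t = s
    · rw [hts]
    by_cases hts' : t = -s
    · rw [hts', breadth_neg]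
    have h1 := lt_supportFn_of_truncated_ball C M hC hd hδ hδR (c := c)
      (fun b hb hsb => (hM _).2 ⟨hball b hb, by rwa [add_sub_cancel_left]⟩) hs1 hv1 hts hts'
    have h2 := width_le_breadth M C hs0
    rw [← hvM, breadth_eq_of_diffSupport_eq_one C M hv1,
      breadth_eq_of_diffSupport_eq_one C M hs1] at h2
    exact absurd (le_of_mul_le_mul_left h2 hd) (not_le.2 (hMs.trans_lt h1))

end Slab

end ConvexGauge

theorem mainTheorem3 (n : ℕ) (hn : 1 ≤ n) (C : ConvexBody (EuclideanSpace ℝ (Fin n)))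
    (hC : (interior (C : Set (EuclideanSpace ℝ (Fin n)))).Nonempty) :
    ConvexGauge.IsPerfect C ↔
      ∀ K Kstar : ConvexBody (EuclideanSpace ℝ (Fin n)),
        ConvexGauge.IsCompletionOf Kstar K C →
          ∀ t : ℝ, t ∈ Set.Icc (0 : ℝ) 1 →
            ConvexGauge.width
                ((t • K + (1 - t) • Kstar : ConvexBody (EuclideanSpace ℝ (Fin n))) :
                  Set (EuclideanSpace ℝ (Fin n))) C
              = t * ConvexGauge.width (K : Set (EuclideanSpace ℝ (Fin n))) C
                + (1 - t) * ConvexGauge.width (Kstar : Set (EuclideanSpace ℝ (Fin n))) C := by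
  constructor
  · intro h K Kstar hcompl t ht
    exact ConvexGauge.width_combo_of_isConstantWidth K Kstar C hn hC (h Kstar hcompl.2.2) ht
  · intro h K hK
    by_contra hconst
    have hw := lt_of_le_of_ne (ConvexGauge.width_le_diameter K C hn hC) hconst
    obtain ⟨M, s, hM, hs, huniq⟩ := hK.exists_cut hn hC hw
    have ht : (1 / 2 : ℝ) ∈ Set.Icc (0 : ℝ) 1 := ⟨by norm_num, by norm_num⟩
    -- equality at the midpoint produces a direction attaining both widths
    obtain ⟨v, hv, hvw⟩ := ConvexGauge.exists_breadth_eq_width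
      ((1 / 2 : ℝ) • M + (1 - 1 / 2 : ℝ) • K) C hn hC
    rw [ConvexGauge.breadth_combo M K C ht, h M K hM _ ht] at hvw
    have h1 := ConvexGauge.width_le_breadth M C hv
    have h2 := ConvexGauge.width_le_breadth K C hv
    have h3 := huniq v hv (by linarith)
    linarith
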